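/- Let $F$ be a free group (of arbitrary rank), and let $H$ and $K$ be nontrivial finitely generated subgroups of $F$, of ranks $h$ and $k$ respectively, with $h \leq k$ and $H \cap K \neq 1$. Let $H \vee K = \langle H, K\rangle$ denote the subgroup of $F$ generated by $H \cup K$. Then $H \cap K$ and $H \vee K$ are finitely generated, and $$\mathrm{rank}(H\cap K) - 1 \;\leq\; 2(h-1)(k-1) - (h-1)\bigl(\mathrm{rank}(H\vee K) - 1\bigr).$$ Here the rank of a finitely generated free group is the number of elements of a free basis, equivalently the smallest number of elements in a generating set. -/

import Mathlib

/-!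
The reduced rank of a free group of rank `r` is `r - 1`. After a conjugation `H ⊓ K` contains a
nontrivial cyclically reduced word, so in the cores of the Schreier graphs of `H`, `K` and `H ⊓ K`
every vertex has degree at least two. The characters of `H` are the integrals of functions on the
edges of its core along loops, hence the reduced rank of `H` is half the sum of `deg v - 2` over the
vertices `v` of the core.

The core of `H ⊓ K` maps to those of `H` and `K`, and embeds into their product. Gluing the two
cores along it yields a graph whose characters include those of `H ⊔ K`; so the number of its edges
exceeds the number of its vertices by at least the reduced rank of `H ⊔ K`.

Order the letters and remove from the star of every vertex of the three cores the least and the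
greatest ray. Twice the reduced rank of `H`, `K` and `H ⊓ K` counts the remaining rays. By
submodularity each of the two removals lowers the number of glued rays by at most the number of
glued vertices, so the remaining rays of `H` and `K` form at least twice the reduced rank of `H ⊔ K`
many classes. The remaining rays of `H ⊓ K` embed into the fibre product of those of `H` and `K`
over the classes, and an elementary inequality for such fibre products gives the bound.
-/

open Module (Dual finrank)

namespace HannaNeumann

section Agreeing

variable {V ι : Type*} {a b : ι → V}

/-- The functions on `V` that take equal values at the two ends `a i`, `b i` of every link `i ∈ E`;
for `E = univ` their dimension counts the components of the graph with links `ι`. -/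
def agreeing (a b : ι → V) (E : Set ι) : Submodule ℚ (V → ℚ) where
  carrier := {u | ∀ i ∈ E, u (a i) = u (b i)}
  add_mem' hu hv i hi := by simp only [Pi.add_apply, hu i hi, hv i hi]
  zero_mem' _ _ := rfl
  smul_mem' c u hu i hi := by simp only [Pi.smul_apply, hu i hi]

theorem mem_agreeing {E : Set ι} {u : V → ℚ} :
    u ∈ agreeing a b E ↔ ∀ i ∈ E, u (a i) = u (b i) := Iff.rfl

theorem agreeing_antitone : Antitone (agreeing a b) :=
  fun _ _ h _ hu i hi => hu i (h hi)

theorem agreeing_union (E₁ E₂ : Set ι) :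
    agreeing a b (E₁ ∪ E₂) = agreeing a b E₁ ⊓ agreeing a b E₂ := by
  ext u
  simp only [Submodule.mem_inf, mem_agreeing, Set.mem_union, or_imp, forall_and]

theorem agreeing_empty : agreeing a b ∅ = ⊤ :=
  eq_top_iff.2 fun _ _ _ hi => hi.elim

theorem finrank_agreeing_submodular [Finite V] {E₁ E₂ : Set ι} (h : E₁ ⊆ E₂) (M : Set ι) :
    finrank ℚ (agreeing a b (E₁ ∪ M)) + finrank ℚ (agreeing a b E₂) ≤
      finrank ℚ (agreeing a b (E₂ ∪ M)) + finrank ℚ (agreeing a b E₁) := by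
  have hinf : agreeing a b (E₁ ∪ M) ⊓ agreeing a b E₂ = agreeing a b (E₂ ∪ M) := by
    rw [← agreeing_union, Set.union_right_comm, Set.union_eq_self_of_subset_left h]
  have hsup : agreeing a b (E₁ ∪ M) ⊔ agreeing a b E₂ ≤ agreeing a b E₁ :=
    sup_le (agreeing_antitone Set.subset_union_left) (agreeing_antitone h)
  rw [← Submodule.finrank_sup_add_finrank_inf_eq, hinf, add_comm]
  exact Nat.add_le_add_left (Submodule.finrank_mono hsup) _

/-- The links `i` with marker `m i = l` are added to links `E l` whose markers come strictly before
`l`, so by submodularity they cost at least as much as when all links are added marker by marker. -/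
theorem sum_finrank_agreeing_union_add_card_le [Fintype V] {L T : Type*} [LinearOrder T]
    (m : ι → L) (f : L → T) (Λ : Finset L) (E : L → Set ι)
    (hE : ∀ l ∈ Λ, ∀ i ∈ E l, f (m i) < f l ∧ m i ∈ Λ) :
    ∑ l ∈ Λ, finrank ℚ (agreeing a b (E l ∪ {i | m i = l})) + Fintype.card V ≤
      ∑ l ∈ Λ, finrank ℚ (agreeing a b (E l)) + finrank ℚ (agreeing a b {i | m i ∈ Λ}) := by
  classical
  induction Λ using Finset.induction_on_max_value f with
  | empty =>
    have : {i | m i ∈ (∅ : Finset L)} = ∅ := by simp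
    rw [this, agreeing_empty]
    simp
  | insert x s hxs hmax ih =>
    have mem_of_lt {l i} (hle : f l ≤ f x) (hi : f (m i) < f l ∧ m i ∈ insert x s) : m i ∈ s :=
      Finset.mem_of_mem_insert_of_ne hi.2 fun h => (hi.1.trans_le hle).ne (congrArg f h)
    have hx : E x ⊆ {i | m i ∈ s} :=
      fun i hi => mem_of_lt le_rfl (hE x (Finset.mem_insert_self _ _) i hi)
    have hstep := finrank_agreeing_submodular (a := a) (b := b) hx {i | m i = x}
    have hunion : {i | m i ∈ s} ∪ {i | m i = x} = {i | m i ∈ insert x s} := by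
      ext i
      simp [or_comm]
    have := ih fun l hl i hi =>
      have h := hE l (Finset.mem_insert_of_mem hl) i hi
      ⟨h.1, mem_of_lt (hmax l hl) h⟩
    rw [hunion] at hstep
    rw [Finset.sum_insert hxs, Finset.sum_insert hxs]
    lia

theorem finrank_agreeing_univ_le_card_quot [Finite V] :
    finrank ℚ (agreeing a b Set.univ) ≤ Nat.card (Quot fun v w => ∃ i, v = a i ∧ w = b i) := by
  let lift : agreeing a b Set.univ →ₗ[ℚ] (Quot fun v w => ∃ i, v = a i ∧ w = b i) → ℚ :=
    { toFun u := Quot.lift u.1 (by rintro _ _ ⟨i, rfl, rfl⟩; exact u.2 i trivial)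
      map_add' _ _ := funext (Quot.ind fun _ => rfl)
      map_smul' _ _ := funext (Quot.ind fun _ => rfl) }
  have : Fintype (Quot fun v w => ∃ i, v = a i ∧ w = b i) := Fintype.ofFinite _
  rw [Nat.card_eq_fintype_card, ← Module.finrank_fintype_fun_eq_card ℚ]
  exact LinearMap.finrank_le_finrank_of_injective (f := lift) fun u u' h =>
    Subtype.ext <| funext fun v => congrFun h (Quot.mk _ v)

end Agreeing

section Stars

variable {V ι L : Type*}

/-- The rays of a family of stars indexed by `V`, the star at `v` having the rays labelled by
`D v`. -/
abbrev Ray (D : V → Finset L) := Σ v, D v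

/-- When the star at `i` is contained in the star at `f i` for each `i`, the rays map along `f`. -/
def rayMap {N : ι → Finset L} {D : V → Finset L} (f : ι → V) (h : ∀ i, N i ⊆ D (f i)) :
    Ray N → Ray D :=
  Sigma.map f fun i l => ⟨l, h i l.2⟩

theorem card_ray [Fintype V] (D : V → Finset L) : Nat.card (Ray D) = ∑ v, (D v).card := by
  simp

theorem finrank_agreeing_rayMap_add [Fintype V] [DecidableEq L] {a b : ι → V} {Λ : Finset L}
    {D : V → Finset L} {N : ι → Finset L} (hD : ∀ v, D v ⊆ Λ)
    (ha : ∀ i, N i ⊆ D (a i)) (hb : ∀ i, N i ⊆ D (b i)) :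
    finrank ℚ (agreeing (rayMap a ha) (rayMap b hb) Set.univ) + ∑ v, (Λ \ D v).card =
      ∑ l ∈ Λ, finrank ℚ (agreeing a b {i | l ∈ N i}) := by
  let e : (∀ l : Λ, agreeing a b {i | l.1 ∈ N i}) ≃ₗ[ℚ]
      agreeing (rayMap a ha) (rayMap b hb) Set.univ × (Ray (fun v => Λ \ D v) → ℚ) :=
    { toFun u :=
        (⟨fun p => (u ⟨p.2, hD _ p.2.2⟩).1 p.1, fun i _ => (u _).2 i.1 i.2.2⟩,
          fun p => (u ⟨p.2, Finset.sdiff_subset p.2.2⟩).1 p.1)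
      invFun x l :=
        ⟨fun v => if h : l.1 ∈ D v then x.1.1 ⟨v, l, h⟩ else x.2 ⟨v, l, by simp [h]⟩, fun i hi => by
          beta_reduce
          rw [dif_pos (ha i hi), dif_pos (hb i hi)]
          exact x.1.2 ⟨i, l, hi⟩ trivial⟩
      map_add' _ _ := rfl
      map_smul' _ _ := rfl
      left_inv u := by
        ext l v
        dsimp only
        split_ifs <;> rfl
      right_inv x := by
        ext p
        · simp
        · simp [(Finset.mem_sdiff.1 p.2.2).2] }
  rw [← card_ray, Nat.card_eq_fintype_card, ← Module.finrank_fintype_fun_eq_card ℚ,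
    ← Module.finrank_prod, ← e.finrank_eq, Module.finrank_pi_fintype, Finset.sum_coe_sort Λ fun l =>
      finrank ℚ (agreeing a b {i | l ∈ N i})]

variable [LinearOrder L]

/-- The elements of a finite set other than its minimum and its maximum. -/
def nonExtremal (D : Finset L) : Finset L :=
  D.filter fun l => (∃ m ∈ D, m < l) ∧ ∃ m ∈ D, l < m

theorem nonExtremal_subset (D : Finset L) : nonExtremal D ⊆ D :=
  Finset.filter_subset _ _

theorem nonExtremal_mono {D D' : Finset L} (h : D ⊆ D') : nonExtremal D ⊆ nonExtremal D' := by
  intro l hl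
  simp only [nonExtremal, Finset.mem_filter] at hl ⊢
  obtain ⟨hlD, ⟨m, hm, hml⟩, n, hn, hln⟩ := hl
  exact ⟨h hlD, ⟨m, h hm, hml⟩, n, h hn, hln⟩

theorem mem_nonExtremal_iff {D : Finset L} (hD : D.Nonempty) {l : L} :
    l ∈ nonExtremal D ↔ l ∈ D ∧ D.min' hD < l ∧ l < D.max' hD := by
  rw [nonExtremal, Finset.mem_filter]
  refine and_congr_right fun _ => and_congr ?_ ?_
  · exact ⟨fun ⟨m, hm, h⟩ => (D.min'_le m hm).trans_lt h, fun h => ⟨_, D.min'_mem hD, h⟩⟩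
  · exact ⟨fun ⟨m, hm, h⟩ => h.trans_le (D.le_max' m hm), fun h => ⟨_, D.max'_mem hD, h⟩⟩

theorem nonExtremal_eq_erase {D : Finset L} (hD : D.Nonempty) :
    nonExtremal D = (D.erase (D.min' hD)).erase (D.max' hD) := by
  ext l
  simp only [mem_nonExtremal_iff hD, Finset.mem_erase]
  refine ⟨fun ⟨hl, hmin, hmax⟩ => ⟨hmax.ne, hmin.ne', hl⟩, fun ⟨hmax, hmin, hl⟩ => ?_⟩
  exact ⟨hl, (D.min'_le l hl).lt_of_ne' hmin, (D.le_max' l hl).lt_of_ne hmax⟩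

theorem card_nonExtremal {D : Finset L} (h : 2 ≤ D.card) :
    (nonExtremal D).card + 2 = D.card := by
  have hD : D.Nonempty := Finset.card_pos.1 (by lia)
  have hne : D.max' hD ≠ D.min' hD := (Finset.min'_lt_max'_of_card D h).ne'
  rw [nonExtremal_eq_erase hD,
    Finset.card_erase_of_mem (Finset.mem_erase.2 ⟨hne, D.max'_mem hD⟩),
    Finset.card_erase_of_mem (D.min'_mem hD)]
  lia

theorem mem_iff_mem_nonExtremal_or {D : Finset L} (hD : D.Nonempty) {l : L} :
    l ∈ D ↔ (l ∈ nonExtremal D ∨ D.min' hD = l) ∨ D.max' hD = l := by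
  rw [nonExtremal_eq_erase hD, Finset.mem_erase, Finset.mem_erase]
  constructor
  · tauto
  · rintro ((⟨-, -, h⟩ | rfl) | rfl)
    exacts [h, D.min'_mem hD, D.max'_mem hD]

/-- Restoring the minimal rays of the links, and then the maximal ones, costs each time at least the
codimension of the functions on the vertices that agree along all links. -/
theorem sum_finrank_agreeing_add_two_mul_card_le [Fintype V] {a b : ι → V} {Λ : Finset L}
    {N : ι → Finset L} (hNΛ : ∀ i, N i ⊆ Λ) (hN : ∀ i, 2 ≤ (N i).card) :
    ∑ l ∈ Λ, finrank ℚ (agreeing a b {i | l ∈ N i}) + 2 * Fintype.card V ≤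
      ∑ l ∈ Λ, finrank ℚ (agreeing a b {i | l ∈ nonExtremal (N i)}) +
        2 * finrank ℚ (agreeing a b Set.univ) := by
  have hne i : (N i).Nonempty := Finset.card_pos.1 (two_pos.trans_le (hN i))
  let first i := (N i).min' (hne i)
  let last i := (N i).max' (hne i)
  have hfirst i : first i ∈ Λ := hNΛ i ((N i).min'_mem _)
  have hlast i : last i ∈ Λ := hNΛ i ((N i).max'_mem _)
  have restore_first := sum_finrank_agreeing_union_add_card_le (a := a) (b := b) first id Λ
    (fun l => {i | l ∈ nonExtremal (N i)})
    fun l _ i hi => ⟨((mem_nonExtremal_iff (hne i)).1 hi).2.1, hfirst i⟩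
  have restore_last := sum_finrank_agreeing_union_add_card_le (a := a) (b := b) last
    OrderDual.toDual Λ (fun l => {i | l ∈ nonExtremal (N i)} ∪ {i | first i = l}) fun l _ i hi => by
      refine ⟨OrderDual.toDual_lt_toDual.2 ?_, hlast i⟩
      rcases hi with hi | rfl
      · exact ((mem_nonExtremal_iff (hne i)).1 hi).2.2
      · exact Finset.min'_lt_max'_of_card _ (hN i)
  have hall l : {i | l ∈ nonExtremal (N i)} ∪ {i | first i = l} ∪ {i | last i = l} =
      {i | l ∈ N i} :=
    Set.ext fun i => (mem_iff_mem_nonExtremal_or (hne i)).symm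
  have hfirst_univ : {i | first i ∈ Λ} = Set.univ := Set.eq_univ_of_forall hfirst
  have hlast_univ : {i | last i ∈ Λ} = Set.univ := Set.eq_univ_of_forall hlast
  rw [hfirst_univ] at restore_first
  rw [hlast_univ, Finset.sum_congr rfl fun l _ => by rw [hall l]] at restore_last
  lia

theorem finrank_agreeing_rayMap_le [Finite V] {a b : ι → V} {D : V → Finset L}
    {N : ι → Finset L} (hD : ∀ v, 2 ≤ (D v).card) (hN : ∀ i, 2 ≤ (N i).card)
    (ha : ∀ i, N i ⊆ D (a i)) (hb : ∀ i, N i ⊆ D (b i)) :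
    finrank ℚ (agreeing (rayMap a ha) (rayMap b hb) Set.univ) ≤
      finrank ℚ (agreeing
          (rayMap (N := fun i => nonExtremal (N i)) (D := fun v => nonExtremal (D v)) a
            fun i => nonExtremal_mono (ha i))
          (rayMap b fun i => nonExtremal_mono (hb i)) Set.univ) +
        2 * finrank ℚ (agreeing a b Set.univ) := by
  have := Fintype.ofFinite V
  let Λ := Finset.univ.biUnion D
  have hDΛ v : D v ⊆ Λ := Finset.subset_biUnion_of_mem D (Finset.mem_univ v)
  have hD'Λ v : nonExtremal (D v) ⊆ Λ := (nonExtremal_subset _).trans (hDΛ v)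
  have hrays := finrank_agreeing_rayMap_add hDΛ ha hb
  have hrays' := finrank_agreeing_rayMap_add (D := fun v => nonExtremal (D v))
    (N := fun i => nonExtremal (N i)) hD'Λ (fun i => nonExtremal_mono (ha i))
    fun i => nonExtremal_mono (hb i)
  have hmissing : ∑ v, (Λ \ nonExtremal (D v)).card =
      ∑ v, (Λ \ D v).card + 2 * Fintype.card V := by
    rw [mul_comm, ← smul_eq_mul, ← Finset.card_univ, ← Finset.sum_const, ← Finset.sum_add_distrib]
    refine Finset.sum_congr rfl fun v _ => ?_
    rw [Finset.card_sdiff_of_subset (hD'Λ v), Finset.card_sdiff_of_subset (hDΛ v)]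
    have := card_nonExtremal (hD v)
    have := Finset.card_le_card (hDΛ v)
    lia
  have := sum_finrank_agreeing_add_two_mul_card_le (a := a) (b := b)
    (fun i => (ha i).trans (hDΛ _)) hN
  omega

end Stars

section Counting

theorem sum_mul_add_sum_mul_card_sub_one_le {Q : Type*} {a b : Q → ℤ} (M : Finset Q)
    (ha : ∀ q ∈ M, 0 ≤ a q) (hb : ∀ q ∈ M, 1 ≤ b q) :
    ∑ q ∈ M, a q * b q + (∑ q ∈ M, a q) * (M.card - 1) ≤ (∑ q ∈ M, a q) * ∑ q ∈ M, b q := by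
  classical
  rw [Finset.sum_mul, Finset.sum_mul, ← Finset.sum_add_distrib]
  refine Finset.sum_le_sum fun q hq => ?_
  have hrest : (M.card : ℤ) - 1 ≤ ∑ r ∈ M.erase q, b r := by
    rw [← Finset.card_erase_add_one hq, Nat.cast_add_one, add_sub_cancel_right]
    simpa using Finset.card_nsmul_le_sum _ b 1 fun r hr => hb r (Finset.mem_of_mem_erase hr)
  rw [← Finset.add_sum_erase M b hq, mul_add]
  gcongr
  exact ha q hq

theorem add_mul_le_mul_add_mul_sub_one {x y p m B j : ℤ} (hy : 0 ≤ y) (hp : 0 ≤ p) (hpx : p ≤ x)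
    (hm : 0 ≤ m) (hmB : m ≤ B) (hxy : x + y ≤ B) (hj : 2 * j ≤ p + m) (h₀ : m = 0 → y = 0) :
    (x + y) * j ≤ x * B + y * (m - 1) := by
  have hx : 0 ≤ x := hp.trans hpx
  obtain rfl | rfl | hm₂ : m = 0 ∨ m = 1 ∨ 2 ≤ m := by lia
  · rw [h₀ rfl, add_zero, zero_mul, add_zero]
    exact mul_le_mul_of_nonneg_left (by lia) hx
  · rw [sub_self, mul_zero, add_zero]
    rcases hp.eq_or_lt with rfl | hp
    · exact (mul_nonpos_of_nonneg_of_nonpos (by lia) (by lia)).trans (mul_nonneg hx (by lia))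
    · calc (x + y) * j ≤ (x + y) * x := mul_le_mul_of_nonneg_left (by lia) (by lia)
        _ ≤ B * x := mul_le_mul_of_nonneg_right hxy hx
        _ = x * B := mul_comm B x
  · have : (x + y) * (2 * j) ≤ (x + y) * (p + m) := mul_le_mul_of_nonneg_left hj (by lia)
    have : x * (x + y) ≤ x * B := mul_le_mul_of_nonneg_left hxy hx
    have : x * m ≤ x * B := mul_le_mul_of_nonneg_left hmB hx
    have : (x + y) * p ≤ (x + y) * x := mul_le_mul_of_nonneg_left hpx (by lia)
    have : y * m ≤ y * (2 * (m - 1)) := mul_le_mul_of_nonneg_left (by lia) hy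
    lia

theorem sum_mul_add_sum_mul_le {Q : Type*} [Fintype Q] {a b : Q → ℤ} (ha : ∀ q, 0 ≤ a q)
    (hb : ∀ q, 0 ≤ b q) (hab : ∀ q, 1 ≤ a q + b q) (hle : ∑ q, a q ≤ ∑ q, b q) {j : ℤ}
    (hj : 2 * j ≤ Fintype.card Q) :
    ∑ q, a q * b q + (∑ q, a q) * j ≤ (∑ q, a q) * ∑ q, b q := by
  classical
  let P := Finset.univ.filter fun q => b q = 0
  let M := Finset.univ.filter fun q => b q ≠ 0
  have split (f : Q → ℤ) : ∑ q ∈ P, f q + ∑ q ∈ M, f q = ∑ q, f q :=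
    Finset.sum_filter_add_sum_filter_not _ _ f
  have hP {q} (hq : q ∈ P) : b q = 0 := (Finset.mem_filter.1 hq).2
  have hM {q} (hq : q ∈ M) : 1 ≤ b q := (hb q).lt_of_ne' (Finset.mem_filter.1 hq).2
  have hbM : ∑ q ∈ M, b q = ∑ q, b q := by
    rw [← split b, Finset.sum_eq_zero fun q => hP, zero_add]
  have habM : ∑ q ∈ M, a q * b q = ∑ q, a q * b q := by
    rw [← split fun q => a q * b q, Finset.sum_eq_zero (s := P) fun q hq => by rw [hP hq, mul_zero],
      zero_add]
  have hPa : (P.card : ℤ) ≤ ∑ q ∈ P, a q := by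
    simpa using Finset.card_nsmul_le_sum P a 1 fun q hq => by simpa [hP hq] using hab q
  have hMb : (M.card : ℤ) ≤ ∑ q ∈ M, b q := by
    simpa using Finset.card_nsmul_le_sum M b 1 fun q => hM
  have hcard : (Fintype.card Q : ℤ) = P.card + M.card := by
    simpa using (split fun _ => 1).symm
  have hcross := sum_mul_add_sum_mul_card_sub_one_le M (fun q _ => ha q) fun q => hM
  have harith := add_mul_le_mul_add_mul_sub_one (Finset.sum_nonneg fun q _ => ha q)
    P.card.cast_nonneg hPa M.card.cast_nonneg (hMb.trans_eq hbM) ((split a).trans_le hle)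
    (hj.trans_eq hcard) fun h => by
      rw [Finset.card_eq_zero.1 (Nat.cast_eq_zero.1 h), Finset.sum_empty]
  rw [hbM, habM] at hcross
  rw [split a] at harith
  linarith [congrArg (· * ∑ q, b q) (split a), add_mul (∑ q ∈ P, a q) (∑ q ∈ M, a q) (∑ q, b q)]

theorem card_eq_sum_card_fiber {A Q : Type*} [Finite A] [Fintype Q] (α : A → Q) :
    Nat.card A = ∑ q, Nat.card {x // α x = q} := by
  rw [← Nat.card_sigma, Nat.card_congr (Equiv.sigmaFiberEquiv α)]

theorem card_pullback {A B Q : Type*} [Finite A] [Finite B] [Fintype Q] (α : A → Q) (β : B → Q) :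
    Nat.card (α.Pullback β) = ∑ q, Nat.card {x // α x = q} * Nat.card {y // β y = q} := by
  let e : α.Pullback β ≃ Σ q, {x // α x = q} × {y // β y = q} :=
    { toFun p := ⟨α p.1.1, ⟨p.1.1, rfl⟩, p.1.2, p.2.symm⟩
      invFun s := ⟨(s.2.1, s.2.2), s.2.1.2.trans s.2.2.2.symm⟩
      left_inv _ := rfl
      right_inv := by rintro ⟨_, ⟨_, rfl⟩, _, _⟩; rfl }
  simp only [Nat.card_congr e, Nat.card_sigma, Nat.card_prod]

theorem card_pullback_add_mul_le {A B Q : Type*} [Finite A] [Finite B] [Finite Q] {α : A → Q}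
    {β : B → Q} (hsurj : Function.Surjective (Sum.elim α β)) (hle : Nat.card A ≤ Nat.card B)
    {j : ℤ} (hj : 2 * j ≤ Nat.card Q) :
    Nat.card (α.Pullback β) + Nat.card A * j ≤ (Nat.card A * Nat.card B : ℤ) := by
  have := Fintype.ofFinite Q
  rw [card_pullback]
  rw [card_eq_sum_card_fiber α, card_eq_sum_card_fiber β] at hle ⊢
  push_cast
  refine sum_mul_add_sum_mul_le (fun _ => Nat.cast_nonneg _) (fun _ => Nat.cast_nonneg _)
    (fun q => ?_) (by exact_mod_cast hle) (by rwa [← Nat.card_eq_fintype_card])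
  rw [← Nat.cast_add, ← Nat.cast_one, Nat.cast_le, ← Nat.card_sum, Nat.one_le_iff_ne_zero,
    ← Nat.pos_iff_ne_zero, Nat.card_pos_iff]
  obtain ⟨x | y, rfl⟩ := hsurj q
  exacts [⟨⟨Sum.inl ⟨x, rfl⟩⟩, inferInstance⟩, ⟨⟨Sum.inr ⟨y, rfl⟩⟩, inferInstance⟩]

variable {VH VK ι V L : Type*}

/-- The ray classes form a set onto which the two ray sets map jointly surjectively, and the rays of
`N` embed into the fibre product of these maps. -/
theorem card_ray_add_mul_le [Finite VH] [Finite VK] {D : VH ⊕ VK → Finset L}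
    {N : ι → Finset L} {a : ι → VH} {b : ι → VK} (hab : Function.Injective fun i => (a i, b i))
    (ha : ∀ i, N i ⊆ D (Sum.inl (a i))) (hb : ∀ i, N i ⊆ D (Sum.inr (b i)))
    (hle : Nat.card (Ray fun v => D (Sum.inl v)) ≤ Nat.card (Ray fun v => D (Sum.inr v))) {j : ℤ}
    (hj : 2 * j ≤
      finrank ℚ (agreeing (rayMap (Sum.inl ∘ a) ha) (rayMap (Sum.inr ∘ b) hb) Set.univ)) :
    Nat.card (Ray N) + Nat.card (Ray fun v => D (Sum.inl v)) * j ≤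
      (Nat.card (Ray fun v => D (Sum.inl v)) * Nat.card (Ray fun v => D (Sum.inr v)) : ℤ) := by
  let Q := Quot fun s t : Ray D =>
    ∃ i, s = rayMap (Sum.inl ∘ a) ha i ∧ t = rayMap (Sum.inr ∘ b) hb i
  let α : (Ray fun v => D (Sum.inl v)) → Q := fun x => Quot.mk _ ⟨Sum.inl x.1, x.2⟩
  let β : (Ray fun v => D (Sum.inr v)) → Q := fun y => Quot.mk _ ⟨Sum.inr y.1, y.2⟩
  have hsurj : Function.Surjective (Sum.elim α β) := by
    rintro ⟨v | v, l⟩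
    exacts [⟨Sum.inl ⟨v, l⟩, rfl⟩, ⟨Sum.inr ⟨v, l⟩, rfl⟩]
  have : Finite Q := Finite.of_surjective _ hsurj
  let e : Ray N → α.Pullback β := fun s =>
    ⟨(rayMap (D := fun v => D (Sum.inl v)) a ha s, rayMap (D := fun v => D (Sum.inr v)) b hb s),
      Quot.sound ⟨s, rfl, rfl⟩⟩
  have he : Function.Injective e := by
    rintro ⟨i, l⟩ ⟨i', l'⟩ h
    obtain rfl : i = i' :=
      hab (Prod.ext (congrArg (fun p => p.1.1.1) h) (congrArg (fun p => p.1.2.1) h))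
    obtain rfl : l = l' := Subtype.ext (congrArg (fun p => (p.1.1.2 : L)) h)
    rfl
  have hclasses : 2 * j ≤ Nat.card Q :=
    hj.trans (Nat.cast_le.2 finrank_agreeing_univ_le_card_quot)
  exact (add_le_add_left (Nat.cast_le.2 (Nat.card_le_card_of_injective e he)) _).trans
    (card_pullback_add_mul_le hsurj hle hclasses)

/-- Minus twice the Euler characteristic of a graph whose vertices `v` have the incident darts
`D v`. -/
def excess [Fintype V] (D : V → Finset L) : ℤ := ∑ v, ((D v).card - 2 : ℤ)

variable [LinearOrder L]

theorem card_ray_nonExtremal [Fintype V] {D : V → Finset L} (hD : ∀ v, 2 ≤ (D v).card) :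
    (Nat.card (Ray fun v => nonExtremal (D v)) : ℤ) = excess D := by
  rw [card_ray, Nat.cast_sum, excess]
  refine Finset.sum_congr rfl fun v _ => ?_
  rw [← card_nonExtremal (hD v)]
  push_cast
  ring

theorem excess_add_excess_mul_le [Fintype VH] [Fintype VK] [Fintype ι] {DH : VH → Finset L}
    {DK : VK → Finset L} {N : ι → Finset L} {a : ι → VH} {b : ι → VK}
    (hab : Function.Injective fun i => (a i, b i)) (hH : ∀ v, 2 ≤ (DH v).card)
    (hK : ∀ v, 2 ≤ (DK v).card) (hN : ∀ i, 2 ≤ (N i).card) (ha : ∀ i, N i ⊆ DH (a i))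
    (hb : ∀ i, N i ⊆ DK (b i)) (hle : excess DH ≤ excess DK) {j : ℤ}
    (hj : 2 * j + 2 * finrank ℚ (agreeing (Sum.inl ∘ a) (Sum.inr ∘ b : ι → VH ⊕ VK) Set.univ) ≤
      finrank ℚ (agreeing (rayMap (D := Sum.elim DH DK) (Sum.inl ∘ a) ha)
        (rayMap (Sum.inr ∘ b) hb) Set.univ)) :
    excess N + excess DH * j ≤ excess DH * excess DK := by
  have hD : ∀ v, 2 ≤ (Sum.elim DH DK v).card := Sum.rec hH hK
  have hstars := finrank_agreeing_rayMap_le (a := Sum.inl ∘ a) (b := Sum.inr ∘ b) hD hN ha hb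
  rw [← card_ray_nonExtremal hH, ← card_ray_nonExtremal hK] at hle ⊢
  rw [← card_ray_nonExtremal hN]
  refine card_ray_add_mul_le (D := fun v => nonExtremal (Sum.elim DH DK v)) hab
    (fun i => nonExtremal_mono (ha i)) (fun i => nonExtremal_mono (hb i)) (Nat.cast_le.1 hle) ?_
  have := hj.trans (Nat.cast_le.2 hstars)
  push_cast at this
  exact le_of_add_le_add_right this

end Counting

section Characters

/-- The rational characters of a group; for a free group they form a space whose dimension is the
rank. -/
abbrev RatChar (A : Type*) [Group A] := Additive A →+ ℚ

variable {A : Type*} [Group A]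

theorem RatChar.apply_conj (χ : RatChar A) (s t : A) :
    χ (Additive.ofMul (s⁻¹ * t * s)) = χ (Additive.ofMul t) := by
  simp only [ofMul_mul, ofMul_inv, map_add, map_neg]
  ring

/-- The reduced rank of a free group, which is its rank minus one; the rank is measured by the
dimension of the space of characters. -/
noncomputable def reducedRank (A : Type*) [Group A] : ℤ := finrank ℚ (RatChar A) - 1

theorem reducedRank_congr {B : Type*} [Group B] (e : A ≃* B) : reducedRank A = reducedRank B := by
  let E : RatChar A ≃ₗ[ℚ] RatChar B :=
    { toFun χ := χ.comp e.symm.toAdditive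
      invFun χ := χ.comp e.toAdditive
      map_add' _ _ := rfl
      map_smul' _ _ := rfl
      left_inv χ := by ext; simp
      right_inv χ := by ext; simp }
  rw [reducedRank, E.finrank_eq, reducedRank]

/-- The values of a character at a family of group elements. -/
def RatChar.eval {ι : Type*} (g : ι → A) : RatChar A →ₗ[ℚ] ι → ℚ where
  toFun χ i := χ (Additive.ofMul (g i))
  map_add' _ _ := rfl
  map_smul' _ _ := rfl

theorem RatChar.eval_injective {ι : Type*} {g : ι → A}
    (hg : Subgroup.closure (Set.range g) = ⊤) : Function.Injective (RatChar.eval g) := by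
  refine fun χ ψ h => AddMonoidHom.toMultiplicativeRight.injective ?_
  refine MonoidHom.eq_of_eqOn_dense hg ?_
  rintro _ ⟨i, rfl⟩
  exact congrFun h i

theorem finiteDimensional_ratChar [Group.FG A] : FiniteDimensional ℚ (RatChar A) := by
  obtain ⟨S, -, hS⟩ := Group.rank_spec A
  exact .of_injective _ (RatChar.eval_injective (g := ((↑) : S → A)) (by simpa using hS))

theorem finrank_ratChar_le_rank [Group.FG A] : finrank ℚ (RatChar A) ≤ Group.rank A := by
  obtain ⟨S, hcard, hS⟩ := Group.rank_spec A
  have := LinearMap.finrank_le_finrank_of_injective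
    (RatChar.eval_injective (g := ((↑) : S → A)) (by simpa using hS))
  simpa [hcard] using this

section IsFreeGroup

variable [IsFreeGroup A]

theorem closure_range_of : Subgroup.closure (Set.range (IsFreeGroup.of (G := A))) = ⊤ := by
  have h : Set.range (IsFreeGroup.of (G := A)) =
      (IsFreeGroup.mulEquiv A).toMonoidHom '' Set.range FreeGroup.of :=
    Set.range_comp _ FreeGroup.of
  rw [h, ← MonoidHom.map_closure, FreeGroup.closure_range_of, ← MonoidHom.range_eq_map]
  exact MonoidHom.range_eq_top.2 (IsFreeGroup.mulEquiv A).surjective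

theorem RatChar.eval_of_surjective :
    Function.Surjective (RatChar.eval (IsFreeGroup.of (G := A))) := fun f =>
  ⟨(IsFreeGroup.lift fun i => Multiplicative.ofAdd (f i)).toAdditiveLeft,
    funext fun i => congrArg Multiplicative.toAdd (IsFreeGroup.lift_of _ i)⟩

theorem exists_generators_card_le_finrank [FiniteDimensional ℚ (RatChar A)] :
    ∃ S : Finset A, S.card ≤ finrank ℚ (RatChar A) ∧ Subgroup.closure (S : Set A) = ⊤ := by
  classical
  have : FiniteDimensional ℚ (IsFreeGroup.Generators A → ℚ) :=
    .of_surjective _ RatChar.eval_of_surjective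
  have : Finite (IsFreeGroup.Generators A) := (Pi.linearIndependent_single_one _ ℚ).finite
  have := Fintype.ofFinite (IsFreeGroup.Generators A)
  refine ⟨Finset.univ.image IsFreeGroup.of, Finset.card_image_le.trans ?_,
    by simpa using closure_range_of (A := A)⟩
  rw [Finset.card_univ, ← Module.finrank_fintype_fun_eq_card ℚ]
  exact LinearMap.finrank_le_finrank_of_surjective RatChar.eval_of_surjective

theorem fg_of_finiteDimensional_ratChar [FiniteDimensional ℚ (RatChar A)] : Group.FG A :=
  have ⟨S, _, hS⟩ := exists_generators_card_le_finrank (A := A)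
  ⟨⟨S, hS⟩⟩

theorem rank_eq_finrank_ratChar [Group.FG A] : Group.rank A = finrank ℚ (RatChar A) := by
  have := finiteDimensional_ratChar (A := A)
  obtain ⟨S, hcard, hS⟩ := exists_generators_card_le_finrank (A := A)
  exact le_antisymm ((Group.rank_le hS).trans hcard) finrank_ratChar_le_rank

theorem rank_sub_one_eq_reducedRank [Group.FG A] : (Group.rank A : ℤ) - 1 = reducedRank A := by
  rw [rank_eq_finrank_ratChar, reducedRank]

end IsFreeGroup

end Characters

section Integration

variable {X Ω : Type*} [MulAction (FreeGroup X) Ω]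

/-- The Schreier graph of `Ω` has an edge `(c, x)` from `c` to `x • c` for every generator `x`. The
skew product acts on the vertices and records the path travelled as a linear functional: the sum
along the path of the values of a function on the edges. -/
def skewProduct : FreeGroup X →* Equiv.Perm (Ω × Dual ℚ (Ω × X → ℚ)) :=
  FreeGroup.lift fun x =>
    { toFun p := (FreeGroup.of x • p.1, p.2 + LinearMap.proj (p.1, x))
      invFun p := ((FreeGroup.of x)⁻¹ • p.1, p.2 - LinearMap.proj ((FreeGroup.of x)⁻¹ • p.1, x))
      left_inv p := by simp
      right_inv p := by simp }

/-- The sum of a function on the edges along the path from `c` spelled by `w`, read from the right,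
edges traversed backwards being counted with a minus sign. -/
def pathIntegral (w : FreeGroup X) (c : Ω) : Dual ℚ (Ω × X → ℚ) := (skewProduct w (c, 0)).2

theorem skewProduct_apply (w : FreeGroup X) (c : Ω) (t : Dual ℚ (Ω × X → ℚ)) :
    skewProduct w (c, t) = (w • c, t + pathIntegral w c) := by
  suffices ∀ c : Ω, ∃ s, ∀ t, skewProduct w (c, t) = (w • c, t + s) by
    obtain ⟨s, hs⟩ := this c
    rw [pathIntegral, hs, hs, zero_add]
  induction w using FreeGroup.induction_on with
  | C1 => exact fun c => ⟨0, fun t => by simp⟩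
  | of x => exact fun c => ⟨LinearMap.proj (c, x), fun t => by simp [skewProduct]⟩
  | inv_of x _ =>
    refine fun c => ⟨-LinearMap.proj ((FreeGroup.of x)⁻¹ • c, x), fun t => ?_⟩
    rw [map_inv, Equiv.Perm.inv_eq_iff_eq]
    simp [skewProduct]
  | mul x y hx hy =>
    intro c
    obtain ⟨s, hs⟩ := hy c
    obtain ⟨s', hs'⟩ := hx (y • c)
    exact ⟨s + s', fun t => by rw [map_mul, Equiv.Perm.mul_apply, hs, hs', mul_smul, add_assoc]⟩

theorem pathIntegral_mul (v w : FreeGroup X) (c : Ω) :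
    pathIntegral (v * w) c = pathIntegral v (w • c) + pathIntegral w c := by
  have h := skewProduct_apply (v * w) c 0
  rw [map_mul, Equiv.Perm.mul_apply, skewProduct_apply, skewProduct_apply, zero_add, zero_add] at h
  exact (congrArg Prod.snd h).symm.trans (add_comm _ _)

theorem pathIntegral_of (x : X) (c : Ω) :
    pathIntegral (FreeGroup.of x) c = LinearMap.proj (c, x) := by
  simp [pathIntegral, skewProduct]

theorem pathIntegral_one (c : Ω) : pathIntegral (1 : FreeGroup X) c = 0 := by
  simp [pathIntegral]

theorem pathIntegral_of_inv (x : X) (c : Ω) :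
    pathIntegral (FreeGroup.of x)⁻¹ c = -LinearMap.proj ((FreeGroup.of x)⁻¹ • c, x) := by
  rw [eq_neg_iff_add_eq_zero, add_comm, ← pathIntegral_of, ← pathIntegral_mul, mul_inv_cancel,
    pathIntegral_one]

theorem eq_pathIntegral {f : Ω × X → ℚ} (J : FreeGroup X → Ω → ℚ)
    (hmul : ∀ v w c, J (v * w) c = J v (w • c) + J w c)
    (hof : ∀ x c, J (FreeGroup.of x) c = f (c, x)) (w : FreeGroup X) (c : Ω) :
    J w c = pathIntegral w c f := by
  have h₁ c : J 1 c = 0 := by simpa using hmul 1 1 c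
  induction w using FreeGroup.induction_on generalizing c with
  | C1 => rw [h₁, pathIntegral_one, LinearMap.zero_apply]
  | of x => rw [hof, pathIntegral_of, LinearMap.proj_apply]
  | inv_of x _ =>
    have h := hmul (FreeGroup.of x) (FreeGroup.of x)⁻¹ c
    rw [mul_inv_cancel, h₁, hof] at h
    rw [pathIntegral_of_inv, LinearMap.neg_apply, LinearMap.proj_apply]
    linarith
  | mul x y hx hy => rw [hmul, hx, hy, pathIntegral_mul, LinearMap.add_apply]

theorem pathIntegral_comp {Ω' : Type*} [MulAction (FreeGroup X) Ω'] {π : Ω' → Ω}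
    (hπ : ∀ (w : FreeGroup X) c, π (w • c) = w • π c) (f : Ω × X → ℚ) (w : FreeGroup X) (c : Ω') :
    pathIntegral w c (f ∘ Prod.map π id) = pathIntegral w (π c) f := by
  refine (eq_pathIntegral (fun w c => pathIntegral w (π c) f) (fun v w c => ?_) (fun x c => ?_) w
    c).symm
  · rw [pathIntegral_mul, hπ, LinearMap.add_apply]
  · rw [pathIntegral_of]
    rfl

/-- The coboundary of a function on the vertices of a graph whose edges `e` lead from `s e` to
`t e`. -/
def coboundary {V E : Type*} (s t : E → V) : (V → ℚ) →ₗ[ℚ] E → ℚ :=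
  LinearMap.funLeft ℚ ℚ t - LinearMap.funLeft ℚ ℚ s

theorem coboundary_apply {V E : Type*} (s t : E → V) (g : V → ℚ) (e : E) :
    coboundary s t g e = g (t e) - g (s e) := rfl

/-- The end of an edge of the Schreier graph of `Ω`. -/
def edgeEnd (e : Ω × X) : Ω := FreeGroup.of e.2 • e.1

theorem pathIntegral_coboundary (g : Ω → ℚ) (w : FreeGroup X) (c : Ω) :
    pathIntegral w c (coboundary Prod.fst edgeEnd g) = g (w • c) - g c := by
  refine (eq_pathIntegral (fun w c => g (w • c) - g c) (fun v w c => ?_) (fun x c => rfl) w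
    c).symm
  rw [mul_smul]
  ring

variable {H : Subgroup (FreeGroup X)}

/-- The base point of the Schreier graph of a subgroup. -/
abbrev base (H : Subgroup (FreeGroup X)) : FreeGroup X ⧸ H := (1 : FreeGroup X)

theorem smul_base (w : FreeGroup X) : w • base H = (w : FreeGroup X ⧸ H) := by
  rw [MulAction.Quotient.smul_coe, smul_eq_mul, mul_one]

theorem smul_base_of_mem {w : FreeGroup X} (hw : w ∈ H) : w • base H = base H := by
  rw [smul_base, QuotientGroup.eq, mul_one]
  exact H.inv_mem hw

variable (H) in
/-- Integration of functions on the edges of the Schreier graph of `H` along the loops at the base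
point; these loops are spelled by the elements of `H`. -/
def loopIntegral : ((FreeGroup X ⧸ H) × X → ℚ) →ₗ[ℚ] RatChar H where
  toFun f := AddMonoidHom.mk' (fun s => pathIntegral s.toMul.1 (base H) f) fun s t => by
    rw [toMul_add, Subgroup.coe_mul, pathIntegral_mul, smul_base_of_mem t.toMul.2,
      LinearMap.add_apply]
  map_add' f g := AddMonoidHom.ext fun s => map_add (pathIntegral s.toMul.1 _) f g
  map_smul' r f := AddMonoidHom.ext fun s => map_smul (pathIntegral s.toMul.1 _) r f

theorem loopIntegral_apply (f : (FreeGroup X ⧸ H) × X → ℚ) (s : H) :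
    loopIntegral H f (Additive.ofMul s) = pathIntegral s.1 (base H) f := rfl

theorem loopIntegral_coboundary (g : FreeGroup X ⧸ H → ℚ) :
    loopIntegral H (coboundary Prod.fst edgeEnd g) = 0 := by
  refine AddMonoidHom.ext fun s => (pathIntegral_coboundary g s.toMul.1 _).trans ?_
  rw [smul_base_of_mem s.toMul.2, sub_self, AddMonoidHom.zero_apply]

theorem loopIntegral_surjective : Function.Surjective (loopIntegral H) := fun χ => by
  have hmem (w : FreeGroup X) (c : FreeGroup X ⧸ H) : (w • c).out⁻¹ * (w * c.out) ∈ H := by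
    rw [← QuotientGroup.eq, QuotientGroup.out_eq', ← smul_eq_mul, ← MulAction.Quotient.smul_coe,
      QuotientGroup.out_eq']
  let J w c := χ (Additive.ofMul ⟨_, hmem w c⟩)
  refine ⟨fun e => J (FreeGroup.of e.2) e.1, AddMonoidHom.ext fun s => ?_⟩
  refine (eq_pathIntegral J (fun v w c => ?_) (fun _ _ => rfl) s.toMul.1 (base H)).symm.trans ?_
  · simp only [J]
    rw [← map_add, ← ofMul_mul]
    congr 2
    ext
    simp only [Subgroup.coe_mul, mul_smul]
    group
  · have hbase : (base H).out ∈ H := by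
      simpa using QuotientGroup.eq.1 (QuotientGroup.out_eq' (base H)).symm
    refine Eq.trans ?_ (RatChar.apply_conj χ ⟨_, hbase⟩ s.toMul)
    simp only [J]
    congr 2
    ext
    simp only [smul_base_of_mem s.toMul.2, Subgroup.coe_mul, Subgroup.coe_inv, mul_assoc]

theorem exists_eq_coboundary {f : (FreeGroup X ⧸ H) × X → ℚ} (hf : loopIntegral H f = 0) :
    ∃ g, f = coboundary Prod.fst edgeEnd g := by
  have hwd {v w : FreeGroup X} (h : (v : FreeGroup X ⧸ H) = w) :
      pathIntegral v (base H) f = pathIntegral w (base H) f := by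
    have h₀ := DFunLike.congr_fun hf (Additive.ofMul ⟨v⁻¹ * w, QuotientGroup.eq.1 h⟩)
    rw [loopIntegral_apply, AddMonoidHom.zero_apply] at h₀
    rw [← mul_inv_cancel_left v w, pathIntegral_mul, smul_base_of_mem (QuotientGroup.eq.1 h),
      LinearMap.add_apply, h₀, add_zero]
  refine ⟨fun c => pathIntegral c.out (base H) f, funext fun ⟨c, x⟩ => ?_⟩
  have hx : pathIntegral (edgeEnd (c, x)).out (base H) f =
      pathIntegral (FreeGroup.of x * c.out) (base H) f := hwd <| by
    rw [QuotientGroup.out_eq', ← smul_eq_mul, ← MulAction.Quotient.smul_coe, QuotientGroup.out_eq',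
      edgeEnd]
  rw [coboundary_apply, hx, pathIntegral_mul, smul_base, QuotientGroup.out_eq', LinearMap.add_apply,
    pathIntegral_of, LinearMap.proj_apply, add_sub_cancel_right]

end Integration

section Paths

open FreeGroup (mk invRev)

variable {X Ω : Type*} [MulAction (FreeGroup X) Ω]

theorem mk_cons (l : X × Bool) (L : List (X × Bool)) : mk (l :: L) = mk [l] * mk L :=
  (FreeGroup.mul_mk (L₁ := [l])).symm

theorem mk_append (L L' : List (X × Bool)) : mk (L ++ L') = mk L * mk L' :=
  FreeGroup.mul_mk.symm

/-- The inverse of a letter. -/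
def flipLetter (l : X × Bool) : X × Bool := (l.1, !l.2)

theorem flipLetter_flipLetter (l : X × Bool) : flipLetter (flipLetter l) = l :=
  Prod.ext rfl (Bool.not_not _)

theorem mk_flipLetter (l : X × Bool) : mk [flipLetter l] = (mk [l])⁻¹ := rfl

theorem invRev_cons (l : X × Bool) (L : List (X × Bool)) :
    invRev (l :: L) = invRev L ++ [flipLetter l] := by
  simp [invRev, flipLetter]

/-- A dart of the Schreier graph of `Ω` is an oriented edge: `(c, l)` leads from `c` to
`mk [l] • c`. -/
abbrev Dart (X Ω : Type*) := Ω × (X × Bool)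

/-- The dart with the opposite orientation. -/
def flipDart (p : Dart X Ω) : Dart X Ω := (mk [p.2] • p.1, flipLetter p.2)

theorem flipDart_flipDart (p : Dart X Ω) : flipDart (flipDart p) = p :=
  Prod.ext (inv_smul_smul (mk [p.2]) p.1) (flipLetter_flipLetter p.2)

/-- The darts of the path from `c` spelled by a list of letters, read from the right. -/
def pathDarts (c : Ω) : List (X × Bool) → Set (Dart X Ω)
  | [] => ∅
  | l :: L => insert (mk L • c, l) (pathDarts c L)

theorem finite_pathDarts (c : Ω) (L : List (X × Bool)) : (pathDarts c L).Finite := by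
  induction L with
  | nil => exact Set.finite_empty
  | cons l L ih => exact ih.insert _

theorem pathDarts_append (c : Ω) (L L' : List (X × Bool)) :
    pathDarts c (L ++ L') = pathDarts (mk L' • c) L ∪ pathDarts c L' := by
  induction L with
  | nil => exact (Set.empty_union _).symm
  | cons l L ih =>
    rw [List.cons_append, pathDarts, pathDarts, ih, mk_append, mul_smul, Set.insert_union]

theorem mem_pathDarts_append_cons (c : Ω) (L₁ : List (X × Bool)) (l : X × Bool)
    (L₂ : List (X × Bool)) : (mk L₂ • c, l) ∈ pathDarts c (L₁ ++ l :: L₂) := by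
  rw [pathDarts_append]
  exact Or.inr (Set.mem_insert _ _)

theorem exists_append_cons_of_mem_pathDarts {c : Ω} {L : List (X × Bool)} {p : Dart X Ω}
    (hp : p ∈ pathDarts c L) : ∃ L₁ l L₂, L = L₁ ++ l :: L₂ ∧ p = (mk L₂ • c, l) := by
  induction L with
  | nil => exact hp.elim
  | cons l L ih =>
    obtain rfl | hp := hp
    · exact ⟨[], l, L, rfl, rfl⟩
    · obtain ⟨L₁, l', L₂, rfl, rfl⟩ := ih hp
      exact ⟨l :: L₁, l', L₂, rfl, rfl⟩

theorem pathDarts_invRev (c : Ω) (L : List (X × Bool)) :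
    pathDarts (mk L • c) (invRev L) = flipDart '' pathDarts c L := by
  induction L with
  | nil => exact (Set.image_empty _).symm
  | cons l L ih =>
    have hl : mk [flipLetter l] • mk (l :: L) • c = mk L • c := by
      rw [mk_flipLetter, mk_cons l L, mul_smul, inv_smul_smul]
    rw [invRev_cons, pathDarts_append, hl, ih, pathDarts, pathDarts, pathDarts, Set.image_insert_eq,
      flipDart, mk_cons l L, mul_smul, ← FreeGroup.one_eq_mk, one_smul, Set.union_insert,
      Set.union_empty]

theorem pathDarts_subset_of_red {c : Ω} {L L' : List (X × Bool)} (h : FreeGroup.Red L L') :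
    pathDarts c L' ⊆ pathDarts c L := by
  induction h with
  | refl => exact Set.Subset.rfl
  | tail _ h ih =>
    obtain @⟨L₁, L₂, x, b⟩ := h
    refine Set.Subset.trans ?_ ih
    have hb : mk ((x, b) :: (x, !b) :: L₂) = mk L₂ :=
      Quot.sound (FreeGroup.Red.Step.not (L₁ := []))
    rw [pathDarts_append, pathDarts_append, hb]
    exact Set.union_subset_union_right _
      ((Set.subset_insert _ _).trans (Set.subset_insert _ _))

theorem pathDarts_map {Ω' : Type*} [MulAction (FreeGroup X) Ω'] {π : Ω' → Ω}
    (hπ : ∀ (w : FreeGroup X) c, π (w • c) = w • π c) (c : Ω') (L : List (X × Bool)) :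
    pathDarts (π c) L = Prod.map π id '' pathDarts c L := by
  induction L with
  | nil => exact (Set.image_empty _).symm
  | cons l L ih => rw [pathDarts, pathDarts, ih, Set.image_insert_eq, Prod.map_apply, hπ, id]

theorem pathIntegral_congr {S : Set (Dart X Ω)} (hS : Set.MapsTo flipDart S S) {f f' : Ω × X → ℚ}
    (hf : ∀ e : Ω × X, (e.1, (e.2, true)) ∈ S → f e = f' e) {c : Ω} {L : List (X × Bool)}
    (hL : pathDarts c L ⊆ S) : pathIntegral (mk L) c f = pathIntegral (mk L) c f' := by
  induction L with
  | nil => simp only [← FreeGroup.one_eq_mk, pathIntegral_one, LinearMap.zero_apply]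
  | cons l L ih =>
    obtain ⟨hl, hL⟩ := Set.insert_subset_iff.1 hL
    rw [mk_cons, pathIntegral_mul, LinearMap.add_apply, LinearMap.add_apply, ih hL]
    congr 1
    obtain ⟨x, _ | _⟩ := l
    · change pathIntegral (FreeGroup.of x)⁻¹ _ _ = pathIntegral (FreeGroup.of x)⁻¹ _ _
      simp only [pathIntegral_of_inv, LinearMap.neg_apply, LinearMap.proj_apply]
      exact congrArg Neg.neg (hf _ (hS hl))
    · change pathIntegral (FreeGroup.of x) _ _ = pathIntegral (FreeGroup.of x) _ _
      simp only [pathIntegral_of, LinearMap.proj_apply]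
      exact hf _ hl

end Paths

section CoreGraph

open FreeGroup (mk invRev IsReduced)

variable {X : Type*}

theorem quotientMapOfLE_smul {G : Type*} [Group G] {H J : Subgroup G} (h : H ≤ J) (g : G)
    (c : G ⧸ H) : Subgroup.quotientMapOfLE h (g • c) = g • Subgroup.quotientMapOfLE h c := by
  induction c using QuotientGroup.induction_on
  rfl

/-- The darts of the core of the Schreier graph of `H`, which is the union of the loops at the base
point spelled by reduced words. -/
def coreDarts (H : Subgroup (FreeGroup X)) : Set (Dart X (FreeGroup X ⧸ H)) :=
  {p | ∃ L, IsReduced L ∧ mk L ∈ H ∧ p ∈ pathDarts (base H) L}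

variable {H J : Subgroup (FreeGroup X)}

theorem pathDarts_subset_coreDarts {L : List (X × Bool)} (hL : IsReduced L) (hLH : mk L ∈ H) :
    pathDarts (base H) L ⊆ coreDarts H := fun _ hp => ⟨L, hL, hLH, hp⟩

theorem mapsTo_flipDart_coreDarts : Set.MapsTo flipDart (coreDarts H) (coreDarts H) := by
  classical
  rintro p ⟨L, hr, hL, hp⟩
  refine ⟨invRev L, ?_, by simpa only [FreeGroup.inv_mk] using H.inv_mem hL, ?_⟩
  · rw [FreeGroup.isReduced_iff_reduce_eq] at hr ⊢
    rw [FreeGroup.reduce_invRev, hr]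
  · rw [← smul_base_of_mem hL, pathDarts_invRev]
    exact Set.mem_image_of_mem _ hp

theorem mapsTo_coreDarts (h : H ≤ J) :
    Set.MapsTo (Prod.map (Subgroup.quotientMapOfLE h) id) (coreDarts H) (coreDarts J) := by
  rintro p ⟨L, hr, hL, hp⟩
  refine ⟨L, hr, h hL, ?_⟩
  rw [show base J = Subgroup.quotientMapOfLE h (base H) from rfl,
    pathDarts_map (quotientMapOfLE_smul h)]
  exact Set.mem_image_of_mem _ hp

/-- The elements of `H` that spell loops whose reduced path stays inside `S`. -/
def loopsIn (H : Subgroup (FreeGroup X)) [DecidableEq X] (S : Set (Dart X (FreeGroup X ⧸ H)))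
    (hS : Set.MapsTo flipDart S S) : Subgroup (FreeGroup X) where
  carrier := {w | w ∈ H ∧ pathDarts (base H) w.toWord ⊆ S}
  one_mem' := ⟨H.one_mem, by simp [pathDarts]⟩
  mul_mem' := by
    rintro v w ⟨hv, hvS⟩ ⟨hw, hwS⟩
    refine ⟨H.mul_mem hv hw, ?_⟩
    rw [FreeGroup.toWord_mul]
    refine (pathDarts_subset_of_red FreeGroup.reduce.red).trans ?_
    rw [pathDarts_append, FreeGroup.mk_toWord, smul_base_of_mem hw]
    exact Set.union_subset hvS hwS
  inv_mem' := by
    rintro w ⟨hw, hwS⟩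
    refine ⟨H.inv_mem hw, ?_⟩
    rw [FreeGroup.toWord_inv, ← smul_base_of_mem (H := H) (w := mk w.toWord)
      (by rwa [FreeGroup.mk_toWord]), pathDarts_invRev]
    exact (Set.image_mono hwS).trans hS.image_subset

instance finite_coreDarts [Group.FG H] : Finite (coreDarts H) := by
  classical
  obtain ⟨G, hG⟩ := (Group.fg_iff_subgroup_fg H).1 ‹_›
  let S₀ := ⋃ g ∈ G, pathDarts (base H) g.toWord
  have hS₀ : S₀.Finite := G.finite_toSet.biUnion fun g _ => finite_pathDarts _ _
  let S := S₀ ∪ flipDart '' S₀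
  have hS : Set.MapsTo flipDart S S := by
    rintro p (hp | ⟨q, hq, rfl⟩)
    · exact Or.inr ⟨p, hp, rfl⟩
    · exact Or.inl (by rwa [flipDart_flipDart])
  have hle : H ≤ loopsIn H S hS := hG.symm.trans_le <| (Subgroup.closure_le _).2 fun g hg =>
    ⟨hG ▸ Subgroup.subset_closure hg, Set.subset_union_of_subset_left
      (Set.subset_biUnion_of_mem (u := fun g => pathDarts (base H) g.toWord) hg) _⟩
  have hSfin : S.Finite := hS₀.union (hS₀.image _)
  refine (hSfin.subset ?_).to_subtype
  rintro p ⟨L, hr, hL, hp⟩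
  rw [← hr.reduce_eq, ← FreeGroup.toWord_mk] at hp
  exact (hle hL).2 hp

theorem quotientMapOfLE_inf_injective {G : Type*} [Group G] (H K : Subgroup G) :
    Function.Injective fun c : G ⧸ (H ⊓ K) =>
      (Subgroup.quotientMapOfLE inf_le_left c, Subgroup.quotientMapOfLE inf_le_right c) := by
  intro c d h
  induction c using QuotientGroup.induction_on
  induction d using QuotientGroup.induction_on
  exact QuotientGroup.eq.2 ⟨QuotientGroup.eq.1 (congrArg Prod.fst h),
    QuotientGroup.eq.1 (congrArg Prod.snd h)⟩

instance finite_coreDarts_inf {K : Subgroup (FreeGroup X)} [Finite (coreDarts H)]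
    [Finite (coreDarts K)] : Finite (coreDarts (H ⊓ K)) := by
  refine Finite.of_injective
    (fun p => ((mapsTo_coreDarts inf_le_left).restrict _ _ _ p,
      (mapsTo_coreDarts inf_le_right).restrict _ _ _ p) :
      coreDarts (H ⊓ K) → coreDarts H × coreDarts K) fun p q h => ?_
  have hH : Prod.map (Subgroup.quotientMapOfLE inf_le_left) id p.1 =
      Prod.map (Subgroup.quotientMapOfLE inf_le_left) id q.1 := congrArg (fun r => r.1.1) h
  have hK : Prod.map (Subgroup.quotientMapOfLE inf_le_right) id p.1 =
      Prod.map (Subgroup.quotientMapOfLE inf_le_right) id q.1 := congrArg (fun r => r.2.1) h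
  refine Subtype.ext (Prod.ext (quotientMapOfLE_inf_injective H K (Prod.ext ?_ ?_)) ?_)
  exacts [(congrArg Prod.fst hH :), (congrArg Prod.fst hK :), (congrArg Prod.snd hH :)]

/-- The vertices of the core. -/
def coreVertices (H : Subgroup (FreeGroup X)) : Set (FreeGroup X ⧸ H) := Prod.fst '' coreDarts H

/-- The edges of the core, in their positive orientation. -/
def coreEdges (H : Subgroup (FreeGroup X)) : Set ((FreeGroup X ⧸ H) × X) :=
  {e | (e.1, (e.2, true)) ∈ coreDarts H}

theorem fst_mem_coreVertices {e : (FreeGroup X ⧸ H) × X} (he : e ∈ coreEdges H) :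
    e.1 ∈ coreVertices H := ⟨_, he, rfl⟩

theorem edgeEnd_mem_coreVertices {e : (FreeGroup X ⧸ H) × X} (he : e ∈ coreEdges H) :
    edgeEnd e ∈ coreVertices H := ⟨_, mapsTo_flipDart_coreDarts he, rfl⟩

theorem base_mem_coreVertices (hH : H ≠ ⊥) : base H ∈ coreVertices H := by
  classical
  obtain ⟨w, hw, hw₁⟩ := H.bot_or_exists_ne_one.resolve_left hH
  obtain ⟨L, l, hL⟩ := (List.eq_nil_or_concat' w.toWord).resolve_left
    (mt FreeGroup.toWord_eq_nil_iff.1 hw₁)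
  have hcore : pathDarts (base H) w.toWord ⊆ coreDarts H :=
    pathDarts_subset_coreDarts FreeGroup.isReduced_toWord (by rwa [FreeGroup.mk_toWord])
  rw [hL] at hcore
  exact ⟨_, hcore (mem_pathDarts_append_cons _ L l []), by rw [← FreeGroup.one_eq_mk, one_smul]⟩

theorem exists_path_of_mem_coreVertices {c : FreeGroup X ⧸ H} (hc : c ∈ coreVertices H) :
    ∃ L, mk L • base H = c ∧ pathDarts (base H) L ⊆ coreDarts H := by
  obtain ⟨_, ⟨L, hr, hL, hp⟩, rfl⟩ := hc
  obtain ⟨L₁, l, L₂, rfl, rfl⟩ := exists_append_cons_of_mem_pathDarts hp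
  refine ⟨L₂, rfl, Set.Subset.trans ?_ (pathDarts_subset_coreDarts hr hL)⟩
  rw [pathDarts_append]
  exact (Set.subset_insert _ _).trans Set.subset_union_right

theorem exists_ne_mem_coreDarts {L : List (X × Bool)} (hL : L ≠ [])
    (hc : FreeGroup.IsCyclicallyReduced L) (hLH : mk L ∈ H) {c : FreeGroup X ⧸ H} {l : X × Bool}
    (h : (c, l) ∈ coreDarts H) : ∃ l' ≠ l, (c, l') ∈ coreDarts H := by
  obtain ⟨M, hr, hM, hp⟩ := h
  obtain ⟨L₁, _, L₂, rfl, ⟨⟩⟩ := exists_append_cons_of_mem_pathDarts hp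
  cases L₂ with
  | cons l₂ L₂ =>
    refine ⟨flipLetter l₂, ?_, ?_⟩
    · rintro rfl
      simpa [flipLetter] using hr.infix (L₁ := [flipLetter l₂, l₂]) ⟨L₁, L₂, by simp⟩
    · rw [mk_cons, mul_smul]
      have h₂ : (mk L₂ • base H, l₂) ∈ coreDarts H := pathDarts_subset_coreDarts hr hM <| by
        simpa using mem_pathDarts_append_cons (base H) (L₁ ++ [l]) l₂ L₂
      exact mapsTo_flipDart_coreDarts h₂
  | nil =>
    rw [← FreeGroup.one_eq_mk, one_smul]
    obtain ⟨L', a, hL'⟩ := (List.eq_nil_or_concat' L).resolve_left hL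
    obtain ⟨b, M, hM⟩ := List.exists_cons_of_ne_nil hL
    have hcore := pathDarts_subset_coreDarts hc.isReduced hLH
    have ha : (base H, a) ∈ coreDarts H := by
      have := hcore (hL' ▸ mem_pathDarts_append_cons _ L' a [])
      rwa [← FreeGroup.one_eq_mk, one_smul] at this
    have hb : (base H, flipLetter b) ∈ coreDarts H := by
      have := mapsTo_flipDart_coreDarts (hcore (hM ▸ mem_pathDarts_append_cons _ [] b M))
      rwa [flipDart, ← mul_smul, ← mk_cons, ← hM, smul_base_of_mem hLH] at this
    have hab : a ≠ flipLetter b := by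
      rintro rfl
      simpa [flipLetter] using hc.2 (flipLetter b) (by simp [hL']) b (by simp [hM]) rfl
    obtain rfl | hal := eq_or_ne a l
    · exact ⟨_, hab.symm, hb⟩
    · exact ⟨a, hal, ha⟩

end CoreGraph

section CoreHomology

open FreeGroup (mk)

variable {X : Type*} {H J : Subgroup (FreeGroup X)}

/-- The start of an edge of the core. -/
def coreSource (e : coreEdges H) : coreVertices H := ⟨e.1.1, fst_mem_coreVertices e.2⟩

/-- The end of an edge of the core. -/
def coreTarget (e : coreEdges H) : coreVertices H := ⟨edgeEnd e.1, edgeEnd_mem_coreVertices e.2⟩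

theorem loopIntegral_congr {f f' : (FreeGroup X ⧸ H) × X → ℚ}
    (h : Set.EqOn f f' (coreEdges H)) : loopIntegral H f = loopIntegral H f' := by
  classical
  refine AddMonoidHom.ext fun s => ?_
  have hs : mk s.toMul.1.toWord ∈ H := by
    rw [FreeGroup.mk_toWord]
    exact s.toMul.2
  have := pathIntegral_congr mapsTo_flipDart_coreDarts h
    (pathDarts_subset_coreDarts FreeGroup.isReduced_toWord hs)
  rwa [FreeGroup.mk_toWord] at this

variable (H) in
/-- Integration of functions on the edges of the core of `H` along the loops at the base point. -/
noncomputable def coreIntegral : (coreEdges H → ℚ) →ₗ[ℚ] RatChar H :=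
  loopIntegral H ∘ₗ Function.ExtendByZero.linearMap ℚ Subtype.val

theorem coreIntegral_restrict (f : (FreeGroup X ⧸ H) × X → ℚ) :
    coreIntegral H (f ∘ Subtype.val) = loopIntegral H f :=
  loopIntegral_congr fun e he =>
    Subtype.val_injective.extend_apply (f ∘ Subtype.val) 0 (⟨e, he⟩ : coreEdges H)

theorem coreIntegral_surjective : Function.Surjective (coreIntegral H) := fun χ =>
  have ⟨f, hf⟩ := loopIntegral_surjective χ
  ⟨_, (coreIntegral_restrict f).trans hf⟩

theorem coboundary_restrict (g : FreeGroup X ⧸ H → ℚ) :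
    coboundary coreSource coreTarget (g ∘ ((↑) : coreVertices H → _)) =
      coboundary Prod.fst edgeEnd g ∘ Subtype.val := rfl

theorem exists_restrict_eq (g : coreVertices H → ℚ) : ∃ g' : FreeGroup X ⧸ H → ℚ,
    g' ∘ Subtype.val = g :=
  ⟨Function.extend Subtype.val g 0, Function.extend_comp Subtype.val_injective g 0⟩

theorem coreIntegral_coboundary (g : coreVertices H → ℚ) :
    coreIntegral H (coboundary coreSource coreTarget g) = 0 := by
  obtain ⟨g, rfl⟩ := exists_restrict_eq g
  rw [coboundary_restrict, coreIntegral_restrict, loopIntegral_coboundary]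

theorem ker_coreIntegral :
    LinearMap.ker (coreIntegral H) = LinearMap.range (coboundary coreSource coreTarget) := by
  refine le_antisymm (fun f hf => ?_) (LinearMap.range_le_ker_iff.2 <|
    LinearMap.ext coreIntegral_coboundary)
  obtain ⟨g, hg⟩ := exists_eq_coboundary (LinearMap.mem_ker.1 hf)
  refine ⟨g ∘ (↑), (coboundary_restrict g).trans ?_⟩
  rw [← hg]
  exact Function.extend_comp Subtype.val_injective f 0

theorem eq_apply_base_of_coboundary_eq_zero {g : coreVertices H → ℚ}
    (hg : coboundary coreSource coreTarget g = 0) (hH : H ≠ ⊥) (c : coreVertices H) :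
    g c = g ⟨base H, base_mem_coreVertices hH⟩ := by
  obtain ⟨g, rfl⟩ := exists_restrict_eq g
  obtain ⟨L, hL, hcore⟩ := exists_path_of_mem_coreVertices c.2
  have h : pathIntegral (mk L) (base H) (coboundary Prod.fst edgeEnd g) =
      pathIntegral (mk L) (base H) 0 :=
    pathIntegral_congr mapsTo_flipDart_coreDarts (fun e he => congrFun hg ⟨e, he⟩) hcore
  rw [pathIntegral_coboundary, map_zero, hL, sub_eq_zero] at h
  exact h

theorem ker_coboundary (hH : H ≠ ⊥) :
    LinearMap.ker (coboundary (coreSource (H := H)) coreTarget) = Submodule.span ℚ {1} := by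
  refine le_antisymm (fun g hg => Submodule.mem_span_singleton.2
      ⟨g ⟨base H, base_mem_coreVertices hH⟩, funext fun c => ?_⟩)
    ((Submodule.span_singleton_le_iff_mem _ _).2 (funext fun _ => sub_self 1))
  exact (mul_one _).trans (eq_apply_base_of_coboundary_eq_zero hg hH c).symm

/-- The map of the vertices of the cores induced by an inclusion of subgroups. -/
def mapVertex (h : H ≤ J) (c : coreVertices H) : coreVertices J :=
  ⟨Subgroup.quotientMapOfLE h c.1, by
    obtain ⟨_, p, hp, rfl⟩ := c
    exact ⟨_, mapsTo_coreDarts h hp, rfl⟩⟩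

/-- The map of the edges of the cores induced by an inclusion of subgroups. -/
def mapEdge (h : H ≤ J) (e : coreEdges H) : coreEdges J :=
  ⟨Prod.map (Subgroup.quotientMapOfLE h) id e.1, mapsTo_coreDarts h e.2⟩

theorem coreSource_mapEdge (h : H ≤ J) (e : coreEdges H) :
    coreSource (mapEdge h e) = mapVertex h (coreSource e) := rfl

theorem coreTarget_mapEdge (h : H ≤ J) (e : coreEdges H) :
    coreTarget (mapEdge h e) = mapVertex h (coreTarget e) :=
  Subtype.ext (quotientMapOfLE_smul h _ _).symm

section Finite

variable [Finite (coreDarts H)]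

instance : Finite (coreVertices H) := Set.Finite.image _ (Set.toFinite (coreDarts H))

instance : Finite (coreEdges H) := Set.Finite.preimage
  (Function.Injective.injOn fun _ _ h => by simpa [Prod.ext_iff] using h)
  (Set.toFinite (coreDarts H))

variable (H) in
theorem finiteDimensional_ratChar_of_finite_coreDarts : FiniteDimensional ℚ (RatChar H) :=
  .of_surjective (coreIntegral H) coreIntegral_surjective

theorem finrank_ratChar_add_card_coreVertices (hH : H ≠ ⊥) :
    finrank ℚ (RatChar H) + Nat.card (coreVertices H) = Nat.card (coreEdges H) + 1 := by
  have := Fintype.ofFinite (coreVertices H)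
  have := Fintype.ofFinite (coreEdges H)
  have hV := (coboundary (coreSource (H := H)) coreTarget).finrank_range_add_finrank_ker
  have hE := (coreIntegral H).finrank_range_add_finrank_ker
  have : Nonempty (coreVertices H) := ⟨⟨_, base_mem_coreVertices hH⟩⟩
  rw [ker_coboundary hH, finrank_span_singleton one_ne_zero, Module.finrank_fintype_fun_eq_card,
    ← Nat.card_eq_fintype_card] at hV
  rw [ker_coreIntegral, LinearMap.range_eq_top.2 (coreIntegral_surjective (H := H)), finrank_top,
    Module.finrank_fintype_fun_eq_card, ← Nat.card_eq_fintype_card] at hE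
  omega

/-- The letters spelling the edges of the core that leave a vertex. -/
noncomputable def letters (H : Subgroup (FreeGroup X)) [Finite (coreDarts H)]
    (c : coreVertices H) : Finset (X × Bool) :=
  ((Set.toFinite (coreDarts H)).preimage (Prod.mk_right_injective c.1).injOn).toFinset

theorem mem_letters {c : coreVertices H} {l : X × Bool} :
    l ∈ letters H c ↔ (c.1, l) ∈ coreDarts H := by
  simp only [letters, Set.Finite.mem_toFinset, Set.mem_preimage]

theorem two_le_card_letters {L : List (X × Bool)} (hL : L ≠ [])
    (hc : FreeGroup.IsCyclicallyReduced L) (hLH : mk L ∈ H) (c : coreVertices H) :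
    2 ≤ (letters H c).card := by
  obtain ⟨_, ⟨⟨_, l⟩, h, rfl⟩⟩ := c
  obtain ⟨l', hne, h'⟩ := exists_ne_mem_coreDarts hL hc hLH h
  exact Finset.one_lt_card.2 ⟨l', mem_letters.2 h', l, mem_letters.2 h, hne⟩

end Finite

section Rays

/-- A dart is an edge together with a direction. -/
def dartEquiv {Ω : Type*} [MulAction (FreeGroup X) Ω] : Dart X Ω ≃ (Ω × X) × Bool where
  toFun p := ((bif p.2.2 then p.1 else mk [p.2] • p.1, p.2.1), p.2.2)
  invFun q := bif q.2 then (q.1.1, (q.1.2, true)) else flipDart (q.1.1, (q.1.2, true))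
  left_inv := by
    rintro ⟨c, x, _ | _⟩
    · exact flipDart_flipDart (c, (x, false))
    · rfl
  right_inv := by
    rintro ⟨⟨c, x⟩, _ | _⟩
    · exact Prod.ext (congrArg (·, x) (congrArg Prod.fst (flipDart_flipDart (c, (x, true))))) rfl
    · rfl

theorem dartEquiv_map {Ω Ω' : Type*} [MulAction (FreeGroup X) Ω] [MulAction (FreeGroup X) Ω']
    {π : Ω' → Ω} (hπ : ∀ (w : FreeGroup X) c, π (w • c) = w • π c) (p : Dart X Ω') :
    dartEquiv (Prod.map π id p) = Prod.map (Prod.map π id) id (dartEquiv p) := by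
  obtain ⟨c, x, _ | _⟩ := p
  · exact Prod.ext (congrArg (·, x) (hπ _ c).symm) rfl
  · rfl

theorem mem_coreDarts_iff (p : Dart X (FreeGroup X ⧸ H)) :
    p ∈ coreDarts H ↔ (dartEquiv p).1 ∈ coreEdges H := by
  obtain ⟨c, x, _ | _⟩ := p
  · refine ⟨fun h => mapsTo_flipDart_coreDarts h, fun h => ?_⟩
    rw [← flipDart_flipDart (c, (x, false))]
    exact mapsTo_flipDart_coreDarts h
  · rfl

variable [Finite (coreDarts H)] [Finite (coreDarts J)]

variable (H) in
/-- The rays of the core are its darts, hence its edges together with a direction. -/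
noncomputable def rayEquiv : Ray (letters H) ≃ coreEdges H × Bool :=
  calc Ray (letters H)
    _ ≃ coreDarts H :=
      { toFun r := ⟨(r.1.1, r.2.1), mem_letters.1 r.2.2⟩
        invFun p := ⟨⟨p.1.1, p.1, p.2, rfl⟩, ⟨p.1.2, mem_letters.2 p.2⟩⟩ }
    _ ≃ {q : ((FreeGroup X ⧸ H) × X) × Bool // q.1 ∈ coreEdges H} :=
      dartEquiv.subtypeEquiv mem_coreDarts_iff
    _ ≃ coreEdges H × Bool := Equiv.prodSubtypeFstEquivSubtypeProd

theorem excess_letters [Fintype (coreVertices H)] (hH : H ≠ ⊥) :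
    excess (letters H) = 2 * reducedRank H := by
  have heuler := finrank_ratChar_add_card_coreVertices hH
  have hrays : ∑ v, (letters H v).card = Nat.card (coreEdges H) * 2 := by
    rw [← card_ray, Nat.card_congr (rayEquiv H), Nat.card_prod,
      Nat.card_eq_fintype_card (α := Bool), Fintype.card_bool]
  rw [excess, Finset.sum_sub_distrib, ← Nat.cast_sum, hrays, Finset.sum_const, Finset.card_univ,
    ← Nat.card_eq_fintype_card, nsmul_eq_mul, reducedRank]
  lia

theorem letters_subset (h : H ≤ J) (c : coreVertices H) :
    letters H c ⊆ letters J (mapVertex h c) :=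
  fun _ hl => mem_letters.2 (mapsTo_coreDarts h (mem_letters.1 hl))

theorem rayEquiv_rayMap (h : H ≤ J) (r : Ray (letters H)) :
    rayEquiv J (rayMap (mapVertex h) (letters_subset h) r) =
      Prod.map (mapEdge h) id (rayEquiv H r) := by
  have := dartEquiv_map (quotientMapOfLE_smul h) (r.1.1, r.2.1)
  exact Prod.ext (Subtype.ext (congrArg Prod.fst this)) rfl

end Rays

end CoreHomology

section GluedCore

theorem finrank_map_add_finrank_ker_inf {k M M' : Type*} [DivisionRing k] [AddCommGroup M]
    [Module k M] [AddCommGroup M'] [Module k M'] (f : M →ₗ[k] M') (P : Submodule k M)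
    [FiniteDimensional k P] :
    finrank k (P.map f) + finrank k (LinearMap.ker f ⊓ P : Submodule k M) = finrank k P := by
  rw [← (f.domRestrict P).finrank_range_add_finrank_ker, LinearMap.range_domRestrict,
    LinearMap.ker_domRestrict, inf_comm, ← Submodule.map_comap_subtype,
    (Submodule.equivMapOfInjective _ P.injective_subtype _).finrank_eq]

theorem finrank_agreeing_le_of_surjective {V W ι κ : Type*} [Finite W] {a b : ι → V}
    {a' b' : κ → W} {φ : W → V} {ψ : κ → ι} (hφ : Function.Surjective φ)
    (ha : ∀ i, φ (a' i) = a (ψ i)) (hb : ∀ i, φ (b' i) = b (ψ i)) :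
    finrank ℚ (agreeing a b Set.univ) ≤ finrank ℚ (agreeing a' b' Set.univ) := by
  have hmap : (agreeing a b Set.univ).map (LinearMap.funLeft ℚ ℚ φ) ≤ agreeing a' b' Set.univ := by
    rintro _ ⟨u, hu, rfl⟩ i -
    simpa only [LinearMap.funLeft_apply, ha, hb] using hu (ψ i) trivial
  rw [(Submodule.equivMapOfInjective _ (LinearMap.funLeft_injective_of_surjective ℚ ℚ φ hφ)
    _).finrank_eq]
  exact Submodule.finrank_mono hmap

theorem card_mul_finrank_agreeing {V ι β : Type*} [Finite V] [Fintype β] {a b : ι → V} :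
    Fintype.card β * finrank ℚ (agreeing a b Set.univ) =
      finrank ℚ (agreeing (Prod.map a (id : β → β)) (Prod.map b id) Set.univ) := by
  let e : (β → agreeing a b Set.univ) ≃ₗ[ℚ]
      agreeing (Prod.map a (id : β → β)) (Prod.map b id) Set.univ :=
    { toFun u := ⟨fun v => (u v.2).1 v.1, fun i _ => (u i.2).2 i.1 trivial⟩
      invFun u s := ⟨fun v => u.1 (v, s), fun i _ => u.2 (i, s) trivial⟩
      map_add' _ _ := rfl
      map_smul' _ _ := rfl }
  rw [← e.finrank_eq, Module.finrank_pi_fintype, Finset.sum_const, Finset.card_univ, smul_eq_mul]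

/-- The restriction of characters to a subgroup. -/
def RatChar.restrict {A : Type*} [Group A] {H J : Subgroup A} (h : H ≤ J) :
    RatChar J →ₗ[ℚ] RatChar H where
  toFun χ := χ.comp (Subgroup.inclusion h).toAdditive
  map_add' _ _ := rfl
  map_smul' _ _ := rfl

theorem RatChar.restrict_sup_injective {A : Type*} [Group A] (H K : Subgroup A) :
    Function.Injective ((RatChar.restrict (le_sup_left : H ≤ H ⊔ K)).prod
      (RatChar.restrict (le_sup_right : K ≤ H ⊔ K))) := by
  refine fun χ ψ h => AddMonoidHom.toMultiplicativeRight.injective ?_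
  refine MonoidHom.eq_of_eqOn_top (show ⊤ ≤ MonoidHom.eqLocus _ _ from ?_)
  rw [← codisjoint_iff.1 (Subgroup.codisjoint_subgroupOf_sup H K)]
  refine sup_le (fun s hs => ?_) fun s hs => ?_
  · exact DFunLike.congr_fun (congrArg Prod.fst h :) (Additive.ofMul ⟨s, hs⟩)
  · exact DFunLike.congr_fun (congrArg Prod.snd h :) (Additive.ofMul ⟨s, hs⟩)

variable {X : Type*}

theorem loopIntegral_comp_quotientMapOfLE {H J : Subgroup (FreeGroup X)} (h : H ≤ J)
    (f : (FreeGroup X ⧸ J) × X → ℚ) :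
    loopIntegral H (f ∘ Prod.map (Subgroup.quotientMapOfLE h) id) =
      RatChar.restrict h (loopIntegral J f) :=
  AddMonoidHom.ext fun s => pathIntegral_comp (quotientMapOfLE_smul h) f s.toMul.1 (base H)

variable (H K : Subgroup (FreeGroup X))

/-- The functions on the vertices of the graph obtained by gluing the cores of `H` and `K` along
the core of `H ⊓ K`. -/
abbrev gluedVertexFunctions : Submodule ℚ (coreVertices H ⊕ coreVertices K → ℚ) :=
  agreeing (Sum.inl ∘ mapVertex (inf_le_left : H ⊓ K ≤ H))
    (Sum.inr ∘ mapVertex (inf_le_right : H ⊓ K ≤ K)) Set.univ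

/-- The functions on the edges of the graph obtained by gluing the cores of `H` and `K` along the
core of `H ⊓ K`. -/
abbrev gluedEdgeFunctions : Submodule ℚ (coreEdges H ⊕ coreEdges K → ℚ) :=
  agreeing (Sum.inl ∘ mapEdge (inf_le_left : H ⊓ K ≤ H))
    (Sum.inr ∘ mapEdge (inf_le_right : H ⊓ K ≤ K)) Set.univ

/-- The coboundary of functions on the disjoint union of the cores of `H` and `K`. -/
def sumCoboundary : (coreVertices H ⊕ coreVertices K → ℚ) →ₗ[ℚ] coreEdges H ⊕ coreEdges K → ℚ :=
  coboundary (Sum.map coreSource coreSource) (Sum.map coreTarget coreTarget)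

/-- Integration along the loops at the base points of the cores of `H` and `K`. -/
noncomputable def sumIntegral :
    (coreEdges H ⊕ coreEdges K → ℚ) →ₗ[ℚ] RatChar H × RatChar K :=
  (coreIntegral H ∘ₗ LinearMap.funLeft ℚ ℚ Sum.inl).prod
    (coreIntegral K ∘ₗ LinearMap.funLeft ℚ ℚ Sum.inr)

theorem sumIntegral_sumCoboundary (g : coreVertices H ⊕ coreVertices K → ℚ) :
    sumIntegral H K (sumCoboundary H K g) = 0 :=
  Prod.ext (coreIntegral_coboundary (g ∘ Sum.inl)) (coreIntegral_coboundary (g ∘ Sum.inr))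

theorem map_sumCoboundary_le :
    (gluedVertexFunctions H K).map (sumCoboundary H K) ≤ gluedEdgeFunctions H K := by
  rintro _ ⟨g, hg, rfl⟩ e -
  change g (.inl (coreTarget _)) - g (.inl (coreSource _)) =
    g (.inr (coreTarget _)) - g (.inr (coreSource _))
  simp only [coreTarget_mapEdge, coreSource_mapEdge]
  exact congrArg₂ (· - ·) (hg (coreTarget e) trivial) (hg (coreSource e) trivial)

theorem range_restrict_prod_le :
    LinearMap.range ((RatChar.restrict (le_sup_left : H ≤ H ⊔ K)).prod
      (RatChar.restrict (le_sup_right : K ≤ H ⊔ K))) ≤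
      (gluedEdgeFunctions H K).map (sumIntegral H K) := by
  rintro _ ⟨χ, rfl⟩
  obtain ⟨f, rfl⟩ := loopIntegral_surjective χ
  refine ⟨Sum.elim (f ∘ Prod.map (Subgroup.quotientMapOfLE le_sup_left) id ∘ Subtype.val)
    (f ∘ Prod.map (Subgroup.quotientMapOfLE le_sup_right) id ∘ Subtype.val), ?_, ?_⟩
  · rintro ⟨⟨c, x⟩, -⟩ -
    induction c using QuotientGroup.induction_on
    rfl
  · exact Prod.ext
      ((coreIntegral_restrict _).trans (loopIntegral_comp_quotientMapOfLE le_sup_left f))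
      ((coreIntegral_restrict _).trans (loopIntegral_comp_quotientMapOfLE le_sup_right f))

variable {H K} in
theorem ker_sumCoboundary_inf_le (hHK : H ⊓ K ≠ ⊥) :
    LinearMap.ker (sumCoboundary H K) ⊓ gluedVertexFunctions H K ≤ Submodule.span ℚ {1} := by
  rintro g ⟨hker, hg⟩
  have hH : coboundary coreSource coreTarget (g ∘ Sum.inl) = 0 :=
    funext fun e => congrFun hker (.inl e)
  have hK : coboundary coreSource coreTarget (g ∘ Sum.inr) = 0 :=
    funext fun e => congrFun hker (.inr e)
  have hbase := hg ⟨base _, base_mem_coreVertices hHK⟩ trivial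
  refine Submodule.mem_span_singleton.2 ⟨g (.inl (mapVertex inf_le_left
    ⟨base _, base_mem_coreVertices hHK⟩)), funext (Sum.rec (fun c => ?_) fun c => ?_)⟩
  · exact (mul_one _).trans
      (eq_apply_base_of_coboundary_eq_zero hH (ne_bot_of_le_ne_bot hHK inf_le_left) c).symm
  · exact ((mul_one _).trans hbase).trans
      (eq_apply_base_of_coboundary_eq_zero hK (ne_bot_of_le_ne_bot hHK inf_le_right) c).symm

variable [Finite (coreDarts H)] [Finite (coreDarts K)]

variable {H K} in
theorem finrank_ratChar_sup_add_le (hHK : H ⊓ K ≠ ⊥) :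
    finrank ℚ (RatChar (H ⊔ K : Subgroup (FreeGroup X))) + finrank ℚ (gluedVertexFunctions H K) ≤
      finrank ℚ (gluedEdgeFunctions H K) + 1 := by
  have hsup : finrank ℚ (RatChar (H ⊔ K : Subgroup (FreeGroup X))) ≤
      finrank ℚ ((gluedEdgeFunctions H K).map (sumIntegral H K)) := by
    rw [← LinearMap.finrank_range_of_inj (RatChar.restrict_sup_injective H K)]
    exact Submodule.finrank_mono (range_restrict_prod_le H K)
  have hrange : finrank ℚ ((gluedVertexFunctions H K).map (sumCoboundary H K)) ≤
      finrank ℚ (LinearMap.ker (sumIntegral H K) ⊓ gluedEdgeFunctions H K : Submodule ℚ _) := by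
    refine Submodule.finrank_mono (le_inf ?_ (map_sumCoboundary_le H K))
    exact Submodule.map_le_iff_le_comap.2 fun g _ => sumIntegral_sumCoboundary H K g
  have hker := (Submodule.finrank_mono (ker_sumCoboundary_inf_le hHK)).trans
    (finrank_span_le_card _)
  rw [Set.toFinset_singleton, Finset.card_singleton] at hker
  have hV := finrank_map_add_finrank_ker_inf (sumCoboundary H K) (gluedVertexFunctions H K)
  have hE := finrank_map_add_finrank_ker_inf (sumIntegral H K) (gluedEdgeFunctions H K)
  omega

/-- The edge and direction of a ray of the disjoint union of the cores of `H` and `K`. -/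
noncomputable def sumRayEdge :
    Ray (Sum.elim (letters H) (letters K)) → (coreEdges H ⊕ coreEdges K) × Bool
  | ⟨.inl v, l⟩ => Prod.map Sum.inl id (rayEquiv H ⟨v, l⟩)
  | ⟨.inr v, l⟩ => Prod.map Sum.inr id (rayEquiv K ⟨v, l⟩)

theorem sumRayEdge_surjective : Function.Surjective (sumRayEdge H K) := by
  rintro ⟨e | e, s⟩
  · obtain ⟨⟨v, l⟩, h⟩ := (rayEquiv H).surjective (e, s)
    exact ⟨⟨.inl v, l⟩, congrArg (Prod.map Sum.inl id) h⟩
  · obtain ⟨⟨v, l⟩, h⟩ := (rayEquiv K).surjective (e, s)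
    exact ⟨⟨.inr v, l⟩, congrArg (Prod.map Sum.inr id) h⟩

theorem two_mul_finrank_gluedEdgeFunctions_le :
    2 * finrank ℚ (gluedEdgeFunctions H K) ≤
      finrank ℚ (agreeing
        (rayMap (N := letters (H ⊓ K)) (D := Sum.elim (letters H) (letters K))
          (Sum.inl ∘ mapVertex inf_le_left) (letters_subset inf_le_left))
        (rayMap (Sum.inr ∘ mapVertex inf_le_right) (letters_subset inf_le_right)) Set.univ) := by
  rw [← Fintype.card_bool, card_mul_finrank_agreeing]
  refine finrank_agreeing_le_of_surjective (ψ := rayEquiv (H ⊓ K)) (sumRayEdge_surjective H K)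
    (fun r => ?_) fun r => ?_
  · exact congrArg (Prod.map Sum.inl id) (rayEquiv_rayMap inf_le_left r)
  · exact congrArg (Prod.map Sum.inr id) (rayEquiv_rayMap inf_le_right r)

variable {H K} in
theorem two_mul_reducedRank_sup_add_le (hHK : H ⊓ K ≠ ⊥) :
    2 * reducedRank (H ⊔ K : Subgroup (FreeGroup X)) + 2 * finrank ℚ (gluedVertexFunctions H K) ≤
      finrank ℚ (agreeing
        (rayMap (N := letters (H ⊓ K)) (D := Sum.elim (letters H) (letters K))
          (Sum.inl ∘ mapVertex inf_le_left) (letters_subset inf_le_left))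
        (rayMap (Sum.inr ∘ mapVertex inf_le_right) (letters_subset inf_le_right)) Set.univ) := by
  have hvertex := finrank_ratChar_sup_add_le hHK
  have hray := two_mul_finrank_gluedEdgeFunctions_le H K
  unfold reducedRank
  omega

end GluedCore

section Main

theorem reducedRank_inf_add_le_of_isCyclicallyReduced {X : Type*} {H K : Subgroup (FreeGroup X)}
    [Finite (coreDarts H)] [Finite (coreDarts K)] {L : List (X × Bool)} (hL : L ≠ [])
    (hc : FreeGroup.IsCyclicallyReduced L) (hLHK : FreeGroup.mk L ∈ H ⊓ K)
    (hle : reducedRank H ≤ reducedRank K) :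
    reducedRank (H ⊓ K : Subgroup _) + reducedRank H * reducedRank (H ⊔ K : Subgroup _) ≤
      2 * reducedRank H * reducedRank K := by
  have := Fintype.ofFinite (coreVertices H)
  have := Fintype.ofFinite (coreVertices K)
  have := Fintype.ofFinite (coreVertices (H ⊓ K))
  let _ : LinearOrder (X × Bool) := IsWellOrder.linearOrder WellOrderingRel
  have hHK : H ⊓ K ≠ ⊥ := by
    classical
    rintro h
    rw [h, Subgroup.mem_bot, ← FreeGroup.toWord_eq_nil_iff, FreeGroup.toWord_mk,
      hc.isReduced.reduce_eq] at hLHK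
    exact hL hLHK
  have hexcess := excess_letters hHK
  have hexcessH := excess_letters (ne_bot_of_le_ne_bot hHK inf_le_left)
  have hexcessK := excess_letters (ne_bot_of_le_ne_bot hHK inf_le_right)
  have hinj : Function.Injective fun c : coreVertices (H ⊓ K) =>
      (mapVertex inf_le_left c, mapVertex inf_le_right c) := fun c d h =>
    Subtype.ext <| quotientMapOfLE_inf_injective H K <| Prod.ext
      (congrArg (fun p => p.1.1) h) (congrArg (fun p => p.2.1) h)
  have key := excess_add_excess_mul_le hinj
    (two_le_card_letters hL hc hLHK.1) (two_le_card_letters hL hc hLHK.2)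
    (two_le_card_letters hL hc hLHK) (letters_subset inf_le_left) (letters_subset inf_le_right)
    (by rwa [hexcessH, hexcessK, mul_le_mul_iff_right₀ two_pos])
    (two_mul_reducedRank_sup_add_le hHK)
  rw [hexcess, hexcessH, hexcessK] at key
  linarith

theorem exists_mulEquiv_isCyclicallyReduced {F : Type*} [Group F] [IsFreeGroup F] {w : F}
    (hw : w ≠ 1) : ∃ (f : F ≃* FreeGroup (IsFreeGroup.Generators F))
      (L : List (IsFreeGroup.Generators F × Bool)),
      L ≠ [] ∧ FreeGroup.IsCyclicallyReduced L ∧ f w = FreeGroup.mk L := by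
  classical
  let e := IsFreeGroup.toFreeGroup F
  let L := (e w).toWord
  let g := FreeGroup.mk (FreeGroup.reduceCyclically.conjugator L)
  have hL : e w = g * FreeGroup.mk (FreeGroup.reduceCyclically L) * g⁻¹ := by
    rw [FreeGroup.inv_mk, FreeGroup.mul_mk, FreeGroup.mul_mk,
      FreeGroup.reduceCyclically.conj_conjugator_reduceCyclically, FreeGroup.mk_toWord]
  refine ⟨e.trans (MulAut.conj g⁻¹), FreeGroup.reduceCyclically L, fun h => ?_,
    FreeGroup.reduceCyclically.isCyclicallyReduced FreeGroup.isReduced_toWord, ?_⟩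
  · rw [h, ← FreeGroup.one_eq_mk, mul_one, mul_inv_cancel] at hL
    exact hw (e.map_eq_one_iff.1 hL)
  · rw [MulEquiv.trans_apply, hL, MulAut.conj_apply]
    group

theorem reducedRank_map {A B : Type*} [Group A] [Group B] (f : A ≃* B) (H : Subgroup A) :
    reducedRank (H.map f.toMonoidHom) = reducedRank H :=
  (reducedRank_congr (f.subgroupMap H)).symm

theorem fg_congr {A B : Type*} [Group A] [Group B] (e : A ≃* B) : Group.FG A ↔ Group.FG B :=
  ⟨fun _ => Group.fg_of_surjective (f := e.toMonoidHom) e.surjective,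
    fun _ => Group.fg_of_surjective (f := e.symm.toMonoidHom) e.symm.surjective⟩

theorem fg_map_iff {A B : Type*} [Group A] [Group B] (f : A ≃* B) {H : Subgroup A} :
    Group.FG (H.map f.toMonoidHom) ↔ Group.FG H :=
  (fg_congr (f.subgroupMap H)).symm

variable {F : Type*} [Group F] [IsFreeGroup F] (H K : Subgroup F) [Group.FG H] [Group.FG K]

theorem fg_inf : Group.FG (H ⊓ K : Subgroup F) := by
  let f := IsFreeGroup.toFreeGroup F
  have := (fg_map_iff f (H := H)).2 ‹_›
  have := (fg_map_iff f (H := K)).2 ‹_›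
  rw [← fg_map_iff f, Subgroup.map_inf H K _ f.injective]
  have := finiteDimensional_ratChar_of_finite_coreDarts (H.map f.toMonoidHom ⊓ K.map f.toMonoidHom)
  exact fg_of_finiteDimensional_ratChar

variable {H K} in
theorem reducedRank_inf_add_le (hHK : H ⊓ K ≠ ⊥) (hle : reducedRank H ≤ reducedRank K) :
    reducedRank (H ⊓ K : Subgroup F) + reducedRank H * reducedRank (H ⊔ K : Subgroup F) ≤
      2 * reducedRank H * reducedRank K := by
  obtain ⟨w, hw, hw₁⟩ := (Subgroup.bot_or_exists_ne_one _).resolve_left hHK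
  obtain ⟨f, L, hL, hc, hfw⟩ := exists_mulEquiv_isCyclicallyReduced hw₁
  have := (fg_map_iff f (H := H)).2 ‹_›
  have := (fg_map_iff f (H := K)).2 ‹_›
  have hLHK : FreeGroup.mk L ∈ H.map f.toMonoidHom ⊓ K.map f.toMonoidHom :=
    hfw ▸ ⟨Subgroup.mem_map_of_mem _ hw.1, Subgroup.mem_map_of_mem _ hw.2⟩
  have key := reducedRank_inf_add_le_of_isCyclicallyReduced hL hc hLHK
    (by rwa [reducedRank_map, reducedRank_map])
  rwa [← Subgroup.map_inf H K _ f.injective, ← Subgroup.map_sup, reducedRank_map, reducedRank_map,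
    reducedRank_map, reducedRank_map] at key

end Main

end HannaNeumann

open HannaNeumann

theorem theorem1p2 {F : Type*} [Group F] [IsFreeGroup F] (H K : Subgroup F)
    [Group.FG H] [Group.FG K] (hH : H ≠ ⊥) (hK : K ≠ ⊥) (h k : ℕ)
    (hh : Group.rank H = h) (hk : Group.rank K = k) (hle : h ≤ k)
    (hHK : H ⊓ K ≠ ⊥) :
    ∃ (_ : Group.FG (H ⊓ K : Subgroup F)) (_ : Group.FG (H ⊔ K : Subgroup F)),
      (Group.rank (H ⊓ K : Subgroup F) : ℤ) - 1 ≤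
        2 * ((h : ℤ) - 1) * ((k : ℤ) - 1) -
          ((h : ℤ) - 1) * ((Group.rank (H ⊔ K : Subgroup F) : ℤ) - 1) := by
  have hinf := fg_inf H K
  have hsup : Group.FG (H ⊔ K : Subgroup F) := (Group.fg_iff_subgroup_fg _).2 <|
    ((Group.fg_iff_subgroup_fg H).1 ‹_›).sup ((Group.fg_iff_subgroup_fg K).1 ‹_›)
  refine ⟨hinf, hsup, ?_⟩
  subst hh hk
  simp only [rank_sub_one_eq_reducedRank]
  refine le_sub_iff_add_le.2 (reducedRank_inf_add_le hHK ?_)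
  simp only [← rank_sub_one_eq_reducedRank]
  lia
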